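/- All quantum systems are finite-dimensional. Write $S(\sigma)=-\operatorname{Tr}[\sigma\log_2\sigma]$ for the von Neumann entropy and $I^{A:B}(\sigma^{AB})=S(\sigma^A)+S(\sigma^B)-S(\sigma^{AB})$ for the quantum mutual information. Let $E_\bullet$ be an entanglement measure; all that is used is that it assigns a real number $E_\bullet(\sigma^{AB})$ to every state $\sigma^{AB}$ of every bipartite system $AB$, in such a way that $$E_\bullet(\sigma^{AB})\le \tfrac12 I^{A:B}(\sigma^{AB})\qquad\text{for all }\sigma^{AB}.$$ Let $\rho^Q$ be a state on $\mathcal H^Q$, let $\mathcal E$ be a channel (completely positive trace-preserving map) from states on $\mathcal H^Q$ to states on $\mathcal H^{Q'}$, let $|\Psi^{RQ}\rangle$ be a purification of $\rho^Q$ with reference system $R$, put $\rho^{RQ'}:=(\mathrm{id}_R\otimes\mathcal E)(|\Psi^{RQ}\rangle\langle\Psi^{RQ}|)$ and define $$\varepsilon_\bullet:=S(\rho^Q)-E_\bullet(\rho^{RQ'}).$$ Then $\varepsilon_\bullet\ge 0$, and there exists a channel $\mathcal R$ from states on $\mathcal H^{Q'}$ to states on $\mathcal H^Q$ such that $$F(\rho^Q,\mathcal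 R\circ\mathcal E)\ \ge\ 1-2\sqrt{\varepsilon_\bullet},$$ where $F(\rho^Q,\mathcal N):=\langle\Phi|(\mathrm{id}\otimes\mathcal N)(|\Phi\rangle\langle\Phi|)|\Phi\rangle$ is the entanglement fidelity, computed with any purification $|\Phi\rangle$ of $\rho^Q$ (the bound holds for each of them). The bound does not depend on the dimensions of the systems. -/

import Mathlib

/-! Finite-dimensional quantum systems. A system with Hilbert space `ℂ^n` is given by a finite index
type `n` (an orthonormal basis); the composite of `A` and `B` is indexed by `A × B`. -/

open scoped ComplexOrder Matrix

universe u v w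

/-- A quantum state (density matrix): a positive semidefinite matrix of trace one. -/
structure DensityMatrix (n : Type u) [Fintype n] where
  mat : Matrix n n ℂ
  posSemidef : mat.PosSemidef
  trace_eq_one : mat.trace = 1

/-- The von Neumann entropy `S(σ) = -Tr[σ log₂ σ]` (in bits), i.e. `-∑ᵢ λᵢ log₂ λᵢ` over the
eigenvalues `λᵢ` of `σ` counted with multiplicity, with the convention `0 log 0 = 0`. -/
noncomputable def vonNeumannEntropy {n : Type u} [Fintype n] [DecidableEq n]
    (σ : DensityMatrix n) : ℝ :=
  -∑ i, σ.posSemidef.isHermitian.eigenvalues i *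
    Real.logb 2 (σ.posSemidef.isHermitian.eigenvalues i)

/-- The reduced state `σ^A = Tr_B σ^{AB}`. -/
def DensityMatrix.marginalLeft {A : Type u} {B : Type v} [Fintype A] [Fintype B]
    (σ : DensityMatrix (A × B)) : DensityMatrix A where
  mat := ∑ b, σ.mat.submatrix (fun a => (a, b)) (fun a => (a, b))
  posSemidef := Matrix.posSemidef_sum _ fun _ _ => σ.posSemidef.submatrix _
  trace_eq_one := by
    rw [Matrix.trace_sum, ← σ.trace_eq_one]
    simp only [Matrix.trace, Matrix.diag, Matrix.submatrix_apply, Fintype.sum_prod_type]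
    exact Finset.sum_comm

/-- The reduced state `σ^B = Tr_A σ^{AB}`. -/
def DensityMatrix.marginalRight {A : Type u} {B : Type v} [Fintype A] [Fintype B]
    (σ : DensityMatrix (A × B)) : DensityMatrix B where
  mat := ∑ a, σ.mat.submatrix (fun b => (a, b)) (fun b => (a, b))
  posSemidef := Matrix.posSemidef_sum _ fun _ _ => σ.posSemidef.submatrix _
  trace_eq_one := by
    rw [Matrix.trace_sum, ← σ.trace_eq_one]
    simp only [Matrix.trace, Matrix.diag, Matrix.submatrix_apply, Fintype.sum_prod_type]

/-- The quantum mutual information `I^{A:B}(σ^{AB}) = S(σ^A) + S(σ^B) - S(σ^{AB})`. -/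
noncomputable def mutualInformation {A : Type u} {B : Type v} [Fintype A] [DecidableEq A]
    [Fintype B] [DecidableEq B] (σ : DensityMatrix (A × B)) : ℝ :=
  vonNeumannEntropy σ.marginalLeft + vonNeumannEntropy σ.marginalRight - vonNeumannEntropy σ

/-- The map `id_R ⊗ N` on operators on `R × A`, for a linear map `N` from operators on `A` to
operators on `B`: it applies `N` to each of the blocks `X_{r s}`, `r s : R`. -/
def ampliate {A : Type u} {B : Type v} (R : Type w)
    (N : Matrix A A ℂ →ₗ[ℂ] Matrix B B ℂ) (X : Matrix (R × A) (R × A) ℂ) :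
    Matrix (R × B) (R × B) ℂ :=
  Matrix.of fun p q => N (X.submatrix (fun a => (p.1, a)) (fun a => (q.1, a))) p.2 q.2

/-- A quantum channel from `A` to `B`: a completely positive trace-preserving linear map. -/
structure Channel (A : Type u) (B : Type v) [Fintype A] [Fintype B] where
  map : Matrix A A ℂ →ₗ[ℂ] Matrix B B ℂ
  completelyPositive : ∀ (k : ℕ) (X : Matrix (Fin k × A) (Fin k × A) ℂ),
    X.PosSemidef → (ampliate (Fin k) map X).PosSemidef
  tracePreserving : ∀ X : Matrix A A ℂ, (map X).trace = X.trace

/-- The composition `M ∘ N` of channels. -/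
def Channel.comp {A : Type u} {B : Type v} {C : Type w} [Fintype A] [Fintype B] [Fintype C]
    (M : Channel B C) (N : Channel A B) : Channel A C where
  map := M.map ∘ₗ N.map
  completelyPositive k X hX :=
    M.completelyPositive k _ (N.completelyPositive k X hX)
  tracePreserving X := by
    simp [M.tracePreserving, N.tracePreserving]

/-- The state `(id_R ⊗ N)(σ^{RA})`. -/
def Channel.applyRight {R : Type w} {A : Type u} {B : Type v} [Fintype R] [Fintype A] [Fintype B]
    (N : Channel A B) (σ : DensityMatrix (R × A)) : DensityMatrix (R × B) where
  mat := ampliate R N.map σ.mat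
  posSemidef := by
    have h := N.completelyPositive (Fintype.card R)
      (σ.mat.submatrix (Prod.map (Fintype.equivFin R).symm id)
        (Prod.map (Fintype.equivFin R).symm id)) (σ.posSemidef.submatrix _)
    have h2 := h.submatrix (Prod.map (Fintype.equivFin R) (id : B → B))
    convert h2 using 1
    ext p q
    simp [ampliate, Function.comp_def]
  trace_eq_one := by
    rw [← σ.trace_eq_one]
    simp only [Matrix.trace, Matrix.diag, Fintype.sum_prod_type]
    exact Finset.sum_congr rfl fun r _ =>
      N.tracePreserving (σ.mat.submatrix (fun a => (r, a)) (fun a => (r, a)))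

/-- A unit vector `|ψ⟩` of the Hilbert space `ℂ^n`. -/
structure StateVector (n : Type u) [Fintype n] where
  vec : n → ℂ
  normalized : star vec ⬝ᵥ vec = 1

/-- The pure state `|ψ⟩⟨ψ|`. -/
def StateVector.pure {n : Type u} [Fintype n] (ψ : StateVector n) : DensityMatrix n where
  mat := Matrix.vecMulVec ψ.vec (star ψ.vec)
  posSemidef := Matrix.posSemidef_vecMulVec_self_star ψ.vec
  trace_eq_one := by
    rw [Matrix.trace_vecMulVec, dotProduct_comm]
    exact ψ.normalized

/-- `ψ^{RQ}` is a purification of `ρ^Q` with reference system `R`: `Tr_R |ψ⟩⟨ψ| = ρ`. -/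
def StateVector.IsPurification {R : Type v} {Q : Type u} [Fintype R] [Fintype Q]
    (ψ : StateVector (R × Q)) (ρ : DensityMatrix Q) : Prop :=
  ψ.pure.marginalRight = ρ

/-- The entanglement fidelity `⟨ψ| (id_R ⊗ N)(|ψ⟩⟨ψ|) |ψ⟩`, computed with the purification `ψ^{RQ}`
of the input state. -/
noncomputable def entanglementFidelity {R : Type v} {Q : Type u} [Fintype R] [Fintype Q]
    (ψ : StateVector (R × Q)) (N : Channel Q Q) : ℝ :=
  (star ψ.vec ⬝ᵥ ((N.applyRight ψ.pure).mat.mulVec ψ.vec)).re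

/-- A real-valued function of all bipartite states `σ^{AB}`, for all finite-dimensional systems
`A` and `B`. (No axioms for entanglement measures are imposed.) -/
def BipartiteMeasure : Type (u + 1) :=
  ∀ (A B : Type u) [Fintype A] [DecidableEq A] [Fintype B] [DecidableEq B],
    DensityMatrix (A × B) → ℝ

/-! The input can be recovered as far as the environment is decoupled from the reference. Kraus
operators of the channel turn the purification into a pure state of the reference R, the output Q'
and an environment E; let τ be its marginal on RE. Complementary marginals of a pure state have
equal spectra, so I(R:E) + I(R:Q') = 2 S(ρ) (`exists_environment_state`), and the hypothesis on the
entanglement measure gives I(R:E) ≤ 2ε whatever the dimensions.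

Decoupling is measured by t = Tr[√τ (√τ^R ⊗ √τ^E)]. In eigenbases t is a classical sum, and log u ≤
u - 1 yields t ≥ 1 - (ln 2) I(R:E)/2 (`exists_overlap`). Since also t ≤ 1, this gives I(R:E) ≥ 0 and
hence ε ≥ 0.

The decoder follows the idea of Uhlmann's theorem (`exists_contractive_recovery`): polar
decompositions of two purifications give operators L_f for which the numbers Tr(L_f K_e ρ), paired
with the entries of √τ^E, sum to t. By Cauchy–Schwarz their squared moduli sum to at least t². They
are terms of the entanglement fidelity, and completing the L_f to a channel
(`exists_channel_extending`) only adds nonnegative terms. Thus F ≥ t². -/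

open scoped Kronecker

/-! ### Entropy as a function of the nonzero spectrum. -/

section Entropy

/-- Makes the entropy a function of the characteristic polynomial alone, so that matrices of
different sizes can be compared. -/
theorem vonNeumannEntropy_eq_sum_roots {n : Type*} [Fintype n] [DecidableEq n]
    (σ : DensityMatrix n) :
    vonNeumannEntropy σ = (σ.mat.charpoly.roots.map
      fun z : ℂ => -(z.re * Real.logb 2 z.re)).sum := by
  rw [σ.posSemidef.isHermitian.roots_charpoly_eq_eigenvalues]
  simp [vonNeumannEntropy]

/-- States with the spectra of `X Y` and of `Y X` have the same entropy. -/
theorem vonNeumannEntropy_eq_of_mul_comm {m n : Type*} [Fintype m] [DecidableEq m] [Fintype n]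
    [DecidableEq n] (σ : DensityMatrix m) (τ : DensityMatrix n) (X : Matrix m n ℂ)
    (Y : Matrix n m ℂ) (hσ : σ.mat.charpoly = (X * Y).charpoly)
    (hτ : τ.mat.charpoly = (Y * X).charpoly) :
    vonNeumannEntropy σ = vonNeumannEntropy τ := by
  have h := congrArg (fun s : Multiset ℂ => (s.map
      fun z : ℂ => -(z.re * Real.logb 2 z.re)).sum)
      (congrArg Polynomial.roots (Matrix.charpoly_mul_comm' X Y))
  rw [← hσ, ← hτ] at h
  have h1 := σ.mat.charpoly_monic.ne_zero
  have h2 := τ.mat.charpoly_monic.ne_zero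
  rw [Polynomial.roots_mul (mul_ne_zero (pow_ne_zero _ Polynomial.X_ne_zero) h1),
    Polynomial.roots_mul (mul_ne_zero (pow_ne_zero _ Polynomial.X_ne_zero) h2)] at h
  rw [vonNeumannEntropy_eq_sum_roots, vonNeumannEntropy_eq_sum_roots]
  -- The powers of the indeterminate contribute only roots 0, where z log z vanishes.
  simpa [Multiset.map_nsmul, Multiset.sum_nsmul] using h

end Entropy

/-! ### Spectral functions, square roots and polar decomposition. -/

section FunctionalCalculus

variable {n : Type*} [Fintype n] [DecidableEq n] {H : Matrix n n ℂ}

/-- The function `f` of a Hermitian matrix, defined through its eigenbasis. -/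
noncomputable def Matrix.IsHermitian.spectralFun (hH : H.IsHermitian) (f : ℝ → ℝ) :
    Matrix n n ℂ :=
  (hH.eigenvectorUnitary : Matrix n n ℂ) * Matrix.diagonal (fun i => (f (hH.eigenvalues i) : ℂ)) *
    (hH.eigenvectorUnitary : Matrix n n ℂ)ᴴ

theorem Matrix.IsHermitian.eigenvectorUnitary_conjTranspose_mul (hH : H.IsHermitian) :
    (hH.eigenvectorUnitary : Matrix n n ℂ)ᴴ * (hH.eigenvectorUnitary : Matrix n n ℂ) = 1 :=
  Unitary.coe_star_mul_self hH.eigenvectorUnitary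

theorem Matrix.IsHermitian.eigenvectorUnitary_mul_conjTranspose (hH : H.IsHermitian) :
    (hH.eigenvectorUnitary : Matrix n n ℂ) * (hH.eigenvectorUnitary : Matrix n n ℂ)ᴴ = 1 :=
  Unitary.coe_mul_star_self hH.eigenvectorUnitary

theorem Matrix.IsHermitian.spectralFun_id (hH : H.IsHermitian) :
    hH.spectralFun (fun x => x) = H :=
  (hH.spectral_theorem.trans (Unitary.conjStarAlgAut_apply _ _)).symm

theorem Matrix.IsHermitian.spectralFun_mul (hH : H.IsHermitian) (f g : ℝ → ℝ) :
    hH.spectralFun f * hH.spectralFun g = hH.spectralFun fun x => f x * g x := by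
  have h := hH.eigenvectorUnitary_conjTranspose_mul
  unfold spectralFun
  generalize (hH.eigenvectorUnitary : Matrix n n ℂ) = V at *
  have : ∀ D E : Matrix n n ℂ, V * D * Vᴴ * (V * E * Vᴴ) = V * (D * (Vᴴ * V) * E) * Vᴴ := by
    intro D E; simp only [Matrix.mul_assoc]
  rw [this, h, Matrix.mul_one, Matrix.diagonal_mul_diagonal]
  simp

theorem Matrix.IsHermitian.conjTranspose_spectralFun (hH : H.IsHermitian) (f : ℝ → ℝ) :
    (hH.spectralFun f)ᴴ = hH.spectralFun f := by
  unfold spectralFun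
  simp only [Matrix.conjTranspose_mul, Matrix.conjTranspose_conjTranspose,
    Matrix.diagonal_conjTranspose, Matrix.mul_assoc]
  congr 3
  ext i
  simp

theorem Matrix.IsHermitian.spectralFun_congr (hH : H.IsHermitian) {f g : ℝ → ℝ}
    (h : ∀ i, f (hH.eigenvalues i) = g (hH.eigenvalues i)) :
    hH.spectralFun f = hH.spectralFun g := by
  unfold spectralFun
  simp only [h]

/-- The square root of a positive semidefinite matrix. -/
noncomputable def Matrix.PosSemidef.root (hH : H.PosSemidef) : Matrix n n ℂ :=
  hH.isHermitian.spectralFun Real.sqrt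

theorem Matrix.PosSemidef.root_mul_root (hH : H.PosSemidef) : hH.root * hH.root = H := by
  conv_rhs => rw [← hH.isHermitian.spectralFun_id]
  rw [root, Matrix.IsHermitian.spectralFun_mul]
  exact hH.isHermitian.spectralFun_congr fun i => Real.mul_self_sqrt (hH.eigenvalues_nonneg i)

theorem Matrix.PosSemidef.conjTranspose_root (hH : H.PosSemidef) : hH.rootᴴ = hH.root :=
  hH.isHermitian.conjTranspose_spectralFun _

/-- For a partial isometry `U`, the matrix `1 - U† U` is a projection. -/
theorem posSemidef_one_sub_of_partialIsometry {l m : Type*} [Fintype l] [Fintype m]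
    [DecidableEq m] {U : Matrix l m ℂ} (h : U * Uᴴ * U = U) : (1 - Uᴴ * U).PosSemidef := by
  have hid : (Uᴴ * U) * (Uᴴ * U) = Uᴴ * U := by
    rw [Matrix.mul_assoc, ← Matrix.mul_assoc U, h]
  have : 1 - Uᴴ * U = (1 - Uᴴ * U)ᴴ * (1 - Uᴴ * U) := by
    have h3 : (Uᴴ * U)ᴴ = Uᴴ * U := by simp
    rw [Matrix.conjTranspose_sub, h3, Matrix.conjTranspose_one, Matrix.sub_mul,
      Matrix.mul_sub, Matrix.mul_sub, hid]
    simp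
  rw [this]
  exact Matrix.posSemidef_conjTranspose_mul_self _

/-- The partial isometry in the polar decomposition `M = √(M M†) U`. -/
theorem exists_polar {m : Type*} [Fintype m] (M : Matrix n m ℂ)
    (hH : H.PosSemidef) (hM : M * Mᴴ = H) :
    ∃ U : Matrix n m ℂ, U * Mᴴ = hH.root ∧ M * Uᴴ = hH.root ∧ U * Uᴴ * U = U := by
  -- As `0⁻¹ = 0`, this is the generalised inverse of √H, vanishing on its kernel; hence `P * M` is
  -- only a partial isometry.
  set P := hH.isHermitian.spectralFun fun x => (√x)⁻¹ with hP
  have hPH : P * H = hH.root := by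
    conv_lhs => enter [2]; rw [← hH.isHermitian.spectralFun_id]
    rw [hP, Matrix.IsHermitian.spectralFun_mul]
    refine hH.isHermitian.spectralFun_congr fun i => ?_
    rw [mul_comm, ← div_eq_mul_inv, Real.div_sqrt]
  have hPP : Pᴴ = P := hH.isHermitian.conjTranspose_spectralFun _
  have h1 : P * M * Mᴴ = hH.root := by rw [Matrix.mul_assoc, hM, hPH]
  refine ⟨P * M, h1, ?_, ?_⟩
  · rw [← hH.conjTranspose_root, ← h1]
    simp [Matrix.mul_assoc]
  · have hQ : P * H * P * P = P := by
      rw [hPH, Matrix.PosSemidef.root, hP, Matrix.IsHermitian.spectralFun_mul,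
        Matrix.IsHermitian.spectralFun_mul]
      refine hH.isHermitian.spectralFun_congr fun i => ?_
      by_cases h : √(hH.isHermitian.eigenvalues i) = 0
      · simp [h]
      · field_simp
    rw [Matrix.conjTranspose_mul, hPP]
    calc P * M * (Mᴴ * P) * (P * M) = P * (M * Mᴴ) * P * P * M := by
          simp only [Matrix.mul_assoc]
      _ = P * M := by rw [hM, hQ]

end FunctionalCalculus

/-! ### The classical overlap inequality. -/

section Overlap

/-- This is log u ≤ u - 1 at u = √(y/x), multiplied by x. The last hypothesis excludes y = 0 < x,
where the convention `Real.log 0 = 0` could make the inequality fail. -/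
theorem mul_one_add_log_div_le_sqrt {x y : ℝ} (hx : 0 ≤ x) (hy : 0 ≤ y) (h : y = 0 → x = 0) :
    x + (x * Real.log y - x * Real.log x) / 2 ≤ √x * √y := by
  rcases hx.eq_or_lt with rfl | hx
  · simp
  have hy : 0 < y := hy.lt_of_ne fun h0 => hx.ne' (h h0.symm)
  have h1 := Real.log_le_sub_one_of_pos (div_pos (Real.sqrt_pos.2 hy) (Real.sqrt_pos.2 hx))
  rw [Real.log_div (Real.sqrt_pos.2 hy).ne' (Real.sqrt_pos.2 hx).ne', Real.log_sqrt hy.le,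
    Real.log_sqrt hx.le] at h1
  have h2 : x * (√y / √x) = √x * √y := by
    have := Real.mul_self_sqrt hx.le
    have h3 := (Real.sqrt_pos.2 hx).ne'
    field_simp
    nlinarith
  nlinarith

/-- The classical estimate behind `exists_overlap`: a joint distribution `p i * c i k l` with marginals
`p`, `a`, `b`. -/
theorem one_add_half_log_sum_le_overlap {ι κ μ : Type*} [Fintype ι] [Fintype κ] [Fintype μ]
    (p : ι → ℝ) (a : κ → ℝ) (b : μ → ℝ) (c : ι → κ → μ → ℝ) (hp : ∀ i, 0 ≤ p i)
    (hc : ∀ i k l, 0 ≤ c i k l)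
    (hp1 : ∑ i, p i = 1) (hrow : ∀ i, ∑ k, ∑ l, c i k l = 1)
    (hka : ∀ k, ∑ i, ∑ l, p i * c i k l = a k) (hlb : ∀ l, ∑ i, ∑ k, p i * c i k l = b l) :
    1 + (∑ k, a k * Real.log (a k) + ∑ l, b l * Real.log (b l) - ∑ i, p i * Real.log (p i)) / 2 ≤
      ∑ i, ∑ k, ∑ l, √(p i) * (√(a k) * √(b l)) * c i k l := by
  have hle_a : ∀ i k l, p i * c i k l ≤ a k := fun i k l => by
    rw [← hka k]
    refine le_trans ?_ (Finset.single_le_sum (f := fun i => ∑ l, p i * c i k l)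
      (fun i _ => Finset.sum_nonneg fun l _ => mul_nonneg (hp i) (hc i k l)) (Finset.mem_univ i))
    exact Finset.single_le_sum (f := fun l => p i * c i k l)
      (fun l _ => mul_nonneg (hp i) (hc i k l)) (Finset.mem_univ l)
  have hle_b : ∀ i k l, p i * c i k l ≤ b l := fun i k l => by
    rw [← hlb l]
    refine le_trans ?_ (Finset.single_le_sum (f := fun i => ∑ k, p i * c i k l)
      (fun i _ => Finset.sum_nonneg fun k _ => mul_nonneg (hp i) (hc i k l)) (Finset.mem_univ i))
    exact Finset.single_le_sum (f := fun k => p i * c i k l)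
      (fun k _ => mul_nonneg (hp i) (hc i k l)) (Finset.mem_univ k)
  have hterm : ∀ i k l, p i * c i k l + (p i * c i k l * Real.log (a k) +
      p i * c i k l * Real.log (b l) - p i * Real.log (p i) * c i k l) / 2 ≤
      √(p i) * (√(a k) * √(b l)) * c i k l := by
    intro i k l
    -- Where the joint weight is zero the whole left side vanishes. Elsewhere `a k` and `b l`
    -- dominate it and are positive, so the logarithm of their product splits.
    rcases (mul_nonneg (hp i) (hc i k l)).eq_or_lt with h0 | h0
    · have : p i * Real.log (p i) * c i k l = 0 := by
        rw [mul_right_comm, ← h0, zero_mul]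
      rw [← h0, this]
      have := hc i k l
      simp only [zero_mul, add_zero, sub_zero, zero_div]
      positivity
    · have h1 : 0 < a k := h0.trans_le (hle_a i k l)
      have h2 : 0 < b l := h0.trans_le (hle_b i k l)
      have h := mul_one_add_log_div_le_sqrt (hp i) (mul_pos h1 h2).le
        fun h => absurd h (mul_pos h1 h2).ne'
      rw [Real.log_mul h1.ne' h2.ne', Real.sqrt_mul h1.le] at h
      have := mul_le_mul_of_nonneg_right h (hc i k l)
      linarith
  have hsum := Finset.sum_le_sum fun i (_ : i ∈ Finset.univ) =>
    Finset.sum_le_sum fun k (_ : k ∈ Finset.univ) =>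
      Finset.sum_le_sum fun l (_ : l ∈ Finset.univ) => hterm i k l
  refine le_trans (le_of_eq ?_) hsum
  simp only [Finset.sum_add_distrib, Finset.sum_sub_distrib, ← Finset.sum_div]
  have e1 : ∑ i, ∑ k, ∑ l, p i * c i k l = 1 := by
    simp_rw [← Finset.mul_sum, hrow, mul_one, hp1]
  have e2 : ∑ i, ∑ k, ∑ l, p i * c i k l * Real.log (a k) = ∑ k, a k * Real.log (a k) := by
    rw [Finset.sum_comm]
    refine Finset.sum_congr rfl fun k _ => ?_
    simp_rw [← Finset.sum_mul, hka]
  have e3 : ∑ i, ∑ k, ∑ l, p i * c i k l * Real.log (b l) = ∑ l, b l * Real.log (b l) := by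
    simp_rw [fun i => Finset.sum_comm (s := Finset.univ (α := κ)) (t := Finset.univ (α := μ))
      (f := fun k l => p i * c i k l * Real.log (b l))]
    rw [Finset.sum_comm]
    refine Finset.sum_congr rfl fun k _ => ?_
    simp_rw [← Finset.sum_mul, hlb]
  have e4 : ∑ i, ∑ k, ∑ l, p i * Real.log (p i) * c i k l = ∑ i, p i * Real.log (p i) := by
    simp_rw [← Finset.mul_sum, hrow, mul_one]
  rw [e1, e2, e3, e4]

end Overlap

/-! ### The quantum overlap, reduced to the classical one. -/

section Overlap

/-- Turns a trace of two spectral functions into a classical sum weighted by the squared overlaps of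
the eigenvectors. -/
theorem trace_conj_diagonal_mul_conj_diagonal {m n : Type*} [Fintype m] [DecidableEq m]
    [Fintype n] [DecidableEq n] (V : Matrix m m ℂ) (W : Matrix m n ℂ) (x : m → ℝ) (y : n → ℝ) :
    (V * Matrix.diagonal (fun i => (x i : ℂ)) * Vᴴ *
      (W * Matrix.diagonal (fun j => (y j : ℂ)) * Wᴴ)).trace =
      ((∑ i, ∑ j, x i * y j * Complex.normSq ((Vᴴ * W) i j) : ℝ) : ℂ) := by
  have h1 : V * Matrix.diagonal (fun i => (x i : ℂ)) * Vᴴ *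
      (W * Matrix.diagonal (fun j => (y j : ℂ)) * Wᴴ) =
      V * (Matrix.diagonal (fun i => (x i : ℂ)) * (Vᴴ * W) *
        Matrix.diagonal (fun j => (y j : ℂ)) * Wᴴ) := by simp only [Matrix.mul_assoc]
  have h2 : Matrix.diagonal (fun i => (x i : ℂ)) * (Vᴴ * W) *
        Matrix.diagonal (fun j => (y j : ℂ)) * Wᴴ * V =
      Matrix.diagonal (fun i => (x i : ℂ)) * (Vᴴ * W) *
        Matrix.diagonal (fun j => (y j : ℂ)) * (Vᴴ * W)ᴴ := by
    simp [Matrix.mul_assoc]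
  rw [h1, Matrix.trace_mul_comm, h2]
  generalize Vᴴ * W = G
  rw [Matrix.trace]
  push_cast
  refine Finset.sum_congr rfl fun i _ => ?_
  rw [Matrix.diag_apply, Matrix.mul_apply]
  refine Finset.sum_congr rfl fun j _ => ?_
  rw [Matrix.mul_diagonal, Matrix.diagonal_mul, Matrix.conjTranspose_apply, ← Complex.mul_conj,
    Complex.star_def]
  ring

theorem sum_normSq_row {m n : Type*} [Fintype m] [DecidableEq m] [Fintype n] (G : Matrix m n ℂ)
    (h : G * Gᴴ = 1) (i : m) : ∑ j, Complex.normSq (G i j) = 1 := by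
  have := congrFun (congrFun h i) i
  rw [Matrix.mul_apply, Matrix.one_apply_eq] at this
  simp only [Matrix.conjTranspose_apply, Complex.star_def, Complex.mul_conj] at this
  exact_mod_cast this

theorem sum_normSq_col {m n : Type*} [Fintype m] [Fintype n] [DecidableEq n] (G : Matrix m n ℂ)
    (h : Gᴴ * G = 1) (j : n) : ∑ i, Complex.normSq (G i j) = 1 := by
  have := sum_normSq_row Gᴴ (by simpa using h) j
  simpa [Matrix.conjTranspose_apply] using this

theorem DensityMatrix.sum_eigenvalues {n : Type*} [Fintype n] [DecidableEq n]
    (σ : DensityMatrix n) : ∑ i, σ.posSemidef.isHermitian.eigenvalues i = 1 := by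
  have := σ.posSemidef.isHermitian.trace_eq_sum_eigenvalues
  rw [σ.trace_eq_one] at this
  exact Complex.ofReal_injective (by simpa using this.symm)

theorem DensityMatrix.log_two_mul_entropy {n : Type*} [Fintype n] [DecidableEq n]
    (σ : DensityMatrix n) : Real.log 2 * vonNeumannEntropy σ =
      -∑ i, σ.posSemidef.isHermitian.eigenvalues i *
        Real.log (σ.posSemidef.isHermitian.eigenvalues i) := by
  have := (Real.log_pos one_lt_two).ne'
  rw [vonNeumannEntropy, mul_neg, Finset.mul_sum]
  congr 1
  refine Finset.sum_congr rfl fun i _ => ?_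
  rw [Real.logb]
  field_simp

theorem DensityMatrix.trace_mul_kronecker_one {A : Type*} {B : Type*} [Fintype A] [DecidableEq A]
    [Fintype B] [DecidableEq B] (σ : DensityMatrix (A × B)) (X : Matrix A A ℂ) :
    (σ.mat * (X ⊗ₖ (1 : Matrix B B ℂ))).trace = (σ.marginalLeft.mat * X).trace := by
  simp only [Matrix.trace, Matrix.diag_apply, Matrix.mul_apply, marginalLeft, Matrix.sum_apply,
    Matrix.submatrix_apply, Fintype.sum_prod_type, Matrix.kroneckerMap_apply, Matrix.one_apply,
    Finset.sum_mul]
  simp only [mul_ite, mul_one, mul_zero, Finset.sum_ite_eq', Finset.mem_univ, if_true]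
theorem DensityMatrix.trace_mul_one_kronecker {A : Type*} {B : Type*} [Fintype A] [DecidableEq A]
    [Fintype B] [DecidableEq B] (σ : DensityMatrix (A × B)) (X : Matrix B B ℂ) :
    (σ.mat * ((1 : Matrix A A ℂ) ⊗ₖ X)).trace = (σ.marginalRight.mat * X).trace := by
  simp only [Matrix.trace, Matrix.diag_apply, Matrix.mul_apply, marginalRight, Matrix.sum_apply,
    Matrix.submatrix_apply, Fintype.sum_prod_type, Matrix.kroneckerMap_apply, Matrix.one_apply,
    Finset.sum_mul]
  simp only [ite_mul, one_mul, zero_mul, mul_ite, mul_zero]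
  rw [Finset.sum_comm]
  refine Finset.sum_congr rfl fun b _ => ?_
  rw [Finset.sum_comm' (t' := Finset.univ) (s' := fun _ => Finset.univ) (by simp)]
  refine Finset.sum_congr rfl fun a _ => ?_
  rw [Finset.sum_comm]
  simp

theorem trace_mul_conj_diagonal_eigenvectorUnitary {n : Type*} [Fintype n] [DecidableEq n]
    {H : Matrix n n ℂ} (hH : H.IsHermitian) (y : n → ℝ) :
    (H * ((hH.eigenvectorUnitary : Matrix n n ℂ) * Matrix.diagonal (fun i => (y i : ℂ)) *
      (hH.eigenvectorUnitary : Matrix n n ℂ)ᴴ)).trace =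
      ((∑ i, hH.eigenvalues i * y i : ℝ) : ℂ) := by
  conv_lhs => enter [1, 1]; rw [← hH.spectralFun_id, Matrix.IsHermitian.spectralFun]
  rw [trace_conj_diagonal_mul_conj_diagonal, hH.eigenvectorUnitary_conjTranspose_mul]
  norm_cast
  refine Finset.sum_congr rfl fun i _ => ?_
  rw [Finset.sum_eq_single i] <;> simp +contextual [eq_comm]

/-- The overlap `Tr[(√σ^A ⊗ √σ^B) √σ^{AB}]` is real and is bounded below in terms of the mutual
information. -/
theorem exists_overlap {A : Type*} {B : Type*} [Fintype A] [DecidableEq A]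
    [Fintype B] [DecidableEq B] (σ : DensityMatrix (A × B)) :
    ∃ t : ℝ, (σ.posSemidef.root *
        (σ.marginalLeft.posSemidef.root ⊗ₖ σ.marginalRight.posSemidef.root)).trace = (t : ℂ) ∧
      1 - Real.log 2 * mutualInformation σ / 2 ≤ t ∧ t ≤ 1 := by
  have hσ := σ.posSemidef.isHermitian
  have hA := σ.marginalLeft.posSemidef.isHermitian
  have hB := σ.marginalRight.posSemidef.isHermitian
  set p := hσ.eigenvalues with hp
  set a := hA.eigenvalues with ha
  set b := hB.eigenvalues with hb
  set V := (hσ.eigenvectorUnitary : Matrix (A × B) (A × B) ℂ) with hV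
  set UA := (hA.eigenvectorUnitary : Matrix A A ℂ) with hUA
  set UB := (hB.eigenvectorUnitary : Matrix B B ℂ) with hUB
  set W : Matrix (A × B) (A × B) ℂ := UA ⊗ₖ UB with hW
  have hWd : ∀ (x : A → ℝ) (y : B → ℝ), (UA * Matrix.diagonal (fun i => (x i : ℂ)) * UAᴴ) ⊗ₖ
      (UB * Matrix.diagonal (fun i => (y i : ℂ)) * UBᴴ) =
      W * Matrix.diagonal (fun i : A × B => ((x i.1 * y i.2 : ℝ) : ℂ)) * Wᴴ := by
    intro x y
    rw [hW, Matrix.conjTranspose_kronecker, Matrix.mul_kronecker_mul, Matrix.mul_kronecker_mul,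
      Matrix.diagonal_kronecker_diagonal]
    simp
  have hVV : V * Vᴴ = 1 := hσ.eigenvectorUnitary_mul_conjTranspose
  have hVV' : Vᴴ * V = 1 := hσ.eigenvectorUnitary_conjTranspose_mul
  have hAA : UA * UAᴴ = 1 := hA.eigenvectorUnitary_mul_conjTranspose
  have hBB : UB * UBᴴ = 1 := hB.eigenvectorUnitary_mul_conjTranspose
  have hWW : W * Wᴴ = 1 := by
    rw [hW, Matrix.conjTranspose_kronecker, ← Matrix.mul_kronecker_mul, hAA, hBB,
      Matrix.one_kronecker_one]
  have hWW' : Wᴴ * W = 1 := by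
    rw [hW, Matrix.conjTranspose_kronecker, ← Matrix.mul_kronecker_mul,
      hA.eigenvectorUnitary_conjTranspose_mul, hB.eigenvectorUnitary_conjTranspose_mul,
      Matrix.one_kronecker_one]
  -- Squared overlaps of the eigenbasis of σ with the product of the eigenbases of its marginals;
  -- doubly stochastic because both bases are orthonormal.
  set c : A × B → A × B → ℝ := fun i j => Complex.normSq ((Vᴴ * W) i j) with hc
  have hc0 : ∀ i j, 0 ≤ c i j := fun i j => Complex.normSq_nonneg _
  have hrow : ∀ i, ∑ j, c i j = 1 := by
    refine sum_normSq_row _ ?_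
    rw [Matrix.conjTranspose_mul, Matrix.conjTranspose_conjTranspose]
    calc Vᴴ * W * (Wᴴ * V) = Vᴴ * (W * Wᴴ) * V := by simp only [Matrix.mul_assoc]
      _ = 1 := by rw [hWW, Matrix.mul_one, hVV']
  have hcol : ∀ j, ∑ i, c i j = 1 := by
    refine sum_normSq_col _ ?_
    rw [Matrix.conjTranspose_mul, Matrix.conjTranspose_conjTranspose]
    calc Wᴴ * V * (Vᴴ * W) = Wᴴ * (V * Vᴴ) * W := by simp only [Matrix.mul_assoc]
      _ = 1 := by rw [hVV, Matrix.mul_one, hWW']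
  have hpσ : V * Matrix.diagonal (fun i => (p i : ℂ)) * Vᴴ = σ.mat := hσ.spectralFun_id
  -- Both sides are the expectation in σ of the k-th eigenprojection of σ^A tensored with 1: the
  -- left evaluated in the eigenbasis of σ, the right by passing to the marginal.
  have hka : ∀ k, ∑ i, ∑ l, p i * c i (k, l) = a k := by
    intro k
    have h1 := trace_conj_diagonal_mul_conj_diagonal V W p
      (fun j : A × B => (if j.1 = k then 1 else 0) * 1)
    rw [← hWd (fun j => if j = k then 1 else 0) (fun _ => 1), hpσ] at h1
    have h2 := trace_mul_conj_diagonal_eigenvectorUnitary hA (fun j => if j = k then 1 else 0)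
    rw [← σ.trace_mul_kronecker_one] at h2
    have h3 : UB * Matrix.diagonal (fun _ => ((1 : ℝ) : ℂ)) * UBᴴ = 1 := by simp [hBB]
    rw [h3, h2] at h1
    have h4 := Complex.ofReal_injective h1
    simp only [mul_ite, mul_one, mul_zero, Finset.sum_ite_eq', Finset.mem_univ, if_true] at h4
    rw [ha, h4]
    refine Finset.sum_congr rfl fun i _ => ?_
    rw [Fintype.sum_prod_type_right]
    simp [c]
  have hlb : ∀ l, ∑ i, ∑ k, p i * c i (k, l) = b l := by
    intro k
    have h1 := trace_conj_diagonal_mul_conj_diagonal V W p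
      (fun j : A × B => 1 * (if j.2 = k then 1 else 0))
    rw [← hWd (fun _ => 1) (fun j => if j = k then 1 else 0), hpσ] at h1
    have h2 := trace_mul_conj_diagonal_eigenvectorUnitary hB (fun j => if j = k then 1 else 0)
    rw [← σ.trace_mul_one_kronecker] at h2
    have h3 : UA * Matrix.diagonal (fun _ => ((1 : ℝ) : ℂ)) * UAᴴ = 1 := by simp [hAA]
    rw [h3, h2] at h1
    have h4 := Complex.ofReal_injective h1
    simp only [mul_ite, mul_one, mul_zero, Finset.sum_ite_eq', Finset.mem_univ, if_true] at h4
    rw [hb, h4]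
    refine Finset.sum_congr rfl fun i _ => ?_
    rw [Fintype.sum_prod_type]
    simp [c]
  have hp1 : ∑ i, p i = 1 := σ.sum_eigenvalues
  have hp0 : ∀ i, 0 ≤ p i := σ.posSemidef.eigenvalues_nonneg
  have ha0 : ∀ i, 0 ≤ a i := σ.marginalLeft.posSemidef.eigenvalues_nonneg
  have hb0 : ∀ i, 0 ≤ b i := σ.marginalRight.posSemidef.eigenvalues_nonneg
  refine ⟨∑ i, ∑ j : A × B, √(p i) * (√(a j.1) * √(b j.2)) * c i j, ?_, ?_, ?_⟩
  · rw [← trace_conj_diagonal_mul_conj_diagonal V W (fun i => √(p i))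
      (fun j : A × B => √(a j.1) * √(b j.2)), ← hWd (fun k => √(a k)) (fun l => √(b l))]
    rfl
  · have h := one_add_half_log_sum_le_overlap p a b (fun i k l => c i (k, l)) hp0 (fun i k l => hc0 _ _) hp1
      (fun i => by rw [← hrow i, Fintype.sum_prod_type]) hka hlb
    have e0 : ∀ i, ∑ j : A × B, √(p i) * (√(a j.1) * √(b j.2)) * c i j =
        ∑ k, ∑ l, √(p i) * (√(a k) * √(b l)) * c i (k, l) := fun i => Fintype.sum_prod_type _
    simp only [e0]
    refine le_trans (le_of_eq ?_) h
    rw [mutualInformation, mul_sub, mul_add]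
    have e1 := σ.marginalLeft.log_two_mul_entropy
    have e2 := σ.marginalRight.log_two_mul_entropy
    have e3 := σ.log_two_mul_entropy
    rw [e1, e2, e3]
    ring
  -- The upper bound is the arithmetic–geometric mean inequality √(xy) ≤ (x + y)/2, summed against
  -- the doubly stochastic weights.
  · have hsum : ∀ i (j : A × B), √(p i) * (√(a j.1) * √(b j.2)) * c i j ≤
        (p i * c i j + a j.1 * b j.2 * c i j) / 2 := by
      intro i j
      have h1 := Real.mul_self_sqrt (hp0 i)
      have h2 := Real.mul_self_sqrt (mul_nonneg (ha0 j.1) (hb0 j.2))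
      rw [← Real.sqrt_mul (ha0 j.1)]
      have := mul_le_mul_of_nonneg_right (two_mul_le_add_sq (√(p i)) (√(a j.1 * b j.2))) (hc0 i j)
      rw [sq, sq, h1, h2] at this
      linarith
    refine (Finset.sum_le_sum fun i _ => Finset.sum_le_sum fun j _ => hsum i j).trans (le_of_eq ?_)
    simp only [← Finset.sum_div, Finset.sum_add_distrib]
    have e1 : ∑ i, ∑ j, p i * c i j = 1 := by simp_rw [← Finset.mul_sum, hrow, mul_one, hp1]
    have e2 : ∑ i, ∑ j : A × B, a j.1 * b j.2 * c i j = 1 := by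
      rw [Finset.sum_comm]
      simp_rw [← Finset.mul_sum, hcol, mul_one]
      rw [Fintype.sum_prod_type]
      simp_rw [← Finset.mul_sum]
      rw [σ.marginalRight.sum_eigenvalues]
      simpa using σ.marginalLeft.sum_eigenvalues
    rw [e1, e2]
    norm_num

end Overlap

/-! ### Kraus operators and entanglement fidelity. -/

section Kraus

/-- Every channel has a Kraus representation. -/
theorem Channel.exists_kraus {A : Type*} {B : Type*} [Fintype A] [Fintype B] (N : Channel A B) :
    ∃ K : A × B → Matrix B A ℂ, ∀ X, N.map X = ∑ e, K e * X * (K e)ᴴ := by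
  classical
  let ι := Fintype.equivFin A
  -- The unnormalised maximally entangled vector; its image `C` is the Choi matrix. The ancilla is
  -- relabelled by `ι` because complete positivity is stated for `Fin k` only.
  let w : Fin (Fintype.card A) × A → ℂ := fun x => if x.2 = ι.symm x.1 then 1 else 0
  let C : Matrix (A × B) (A × B) ℂ := (ampliate (Fin (Fintype.card A)) N.map
    (Matrix.vecMulVec w (star w))).submatrix (Prod.map ι id) (Prod.map ι id)
  have hC : C.PosSemidef := (N.completelyPositive (Fintype.card A) _
    (Matrix.posSemidef_vecMulVec_self_star w)).submatrix _
  obtain ⟨L, hL⟩ : ∃ L : Matrix (A × B) (A × B) ℂ, C = Lᴴ * L :=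
    ⟨hC.root, by rw [hC.conjTranspose_root, hC.root_mul_root]⟩
  -- Each row of a factor `L` of the Choi matrix, conjugated and reshaped, is a Kraus operator.
  refine ⟨fun e => Matrix.of fun b a => star (L e (a, b)), fun X => ?_⟩
  have hsingle : ∀ q q' a b, N.map (Matrix.single q q' 1) a b =
      ∑ e, star (L e (q, a)) * L e (q', b) := by
    intro q q' a b
    have h := congrFun (congrFun hL (q, a)) (q', b)
    rw [Matrix.mul_apply] at h
    simp only [Matrix.conjTranspose_apply] at h
    rw [← h]
    simp only [C, ampliate, Matrix.submatrix_apply, Prod.map_apply, id_eq, Matrix.of_apply]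
    refine congrFun (congrFun (congrArg N.map ?_) a) b
    ext c d
    simp only [Matrix.single_apply, Matrix.submatrix_apply, Matrix.vecMulVec_apply, w,
      Equiv.symm_apply_apply, Pi.star_apply]
    rw [@eq_comm _ q, @eq_comm _ q']
    by_cases h1 : c = q <;> by_cases h2 : d = q' <;> simp [h1, h2]
  have hX : X = ∑ q, ∑ q', X q q' • Matrix.single q q' (1 : ℂ) := by
    conv_lhs => rw [Matrix.matrix_eq_sum_single X]
    simp
  ext a b
  conv_lhs => rw [hX]
  simp only [map_sum, map_smul, Matrix.sum_apply, Matrix.smul_apply, hsingle, smul_eq_mul,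
    Matrix.mul_apply, Matrix.of_apply, Matrix.conjTranspose_apply, star_star, Finset.mul_sum,
    Finset.sum_mul]
  rw [Finset.sum_comm]
  simp_rw [fun q => Finset.sum_comm (s := (Finset.univ : Finset A))
    (t := (Finset.univ : Finset (A × B)))
    (f := fun q' e => X q' q * (star (L e (q', a)) * L e (q, b)))]
  rw [Finset.sum_comm]
  refine Finset.sum_congr rfl fun e _ => Finset.sum_congr rfl fun q _ =>
    Finset.sum_congr rfl fun q' _ => ?_
  ring

/-- The channel with the given Kraus operators. -/
def Channel.ofKraus {A : Type*} {B : Type*} {κ : Type*} [Fintype A] [DecidableEq A] [Fintype B]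
    [Fintype κ] (K : κ → Matrix B A ℂ) (hK : ∑ k, (K k)ᴴ * K k = 1) : Channel A B where
  map :=
    { toFun := fun X => ∑ k, K k * X * (K k)ᴴ
      map_add' := fun X Y => by simp [Matrix.mul_add, Matrix.add_mul, Finset.sum_add_distrib]
      map_smul' := fun c X => by simp [Finset.smul_sum] }
  completelyPositive n X hX := by
    have : ampliate (Fin n) (⟨⟨fun X => ∑ k, K k * X * (K k)ᴴ,
          fun X Y => by simp [Matrix.mul_add, Matrix.add_mul, Finset.sum_add_distrib]⟩,
          fun c X => by simp [Finset.smul_sum]⟩ : Matrix A A ℂ →ₗ[ℂ] Matrix B B ℂ) X =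
        ∑ k, ((1 : Matrix (Fin n) (Fin n) ℂ) ⊗ₖ K k) * X *
          ((1 : Matrix (Fin n) (Fin n) ℂ) ⊗ₖ K k)ᴴ := by
      ext ⟨i, a⟩ ⟨j, b⟩
      simp [ampliate, Matrix.sum_apply, Matrix.mul_apply, Fintype.sum_prod_type,
        Matrix.one_apply, ite_mul, apply_ite (starRingEnd ℂ)]
    rw [this]
    exact Matrix.posSemidef_sum _ fun k _ => hX.mul_mul_conjTranspose_same _
  tracePreserving X := by
    simp only [LinearMap.coe_mk, AddHom.coe_mk, Matrix.trace_sum]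
    have : ∀ k, (K k * X * (K k)ᴴ).trace = ((K k)ᴴ * K k * X).trace := fun k => by
      rw [Matrix.trace_mul_comm, Matrix.mul_assoc]
    simp_rw [this]
    rw [← Matrix.trace_sum, ← Finset.sum_mul, hK, Matrix.one_mul]

theorem StateVector.IsPurification.mat_apply {R : Type*} {Q : Type*} [Fintype R] [Fintype Q]
    {φ : StateVector (R × Q)} {ρ : DensityMatrix Q} (h : φ.IsPurification ρ) (q q' : Q) :
    ρ.mat q q' = ∑ r, φ.vec (r, q) * star (φ.vec (r, q')) := by
  rw [← h]
  simp [StateVector.pure, DensityMatrix.marginalRight, Matrix.sum_apply,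
    Matrix.vecMulVec_apply]

theorem Channel.applyRight_pure_apply {R : Type*} {Q : Type*} {B : Type*} {E : Type*} [Fintype R]
    [Fintype Q] [Fintype B] [Fintype E] (N : Channel Q B) (K : E → Matrix B Q ℂ)
    (hK : ∀ X, N.map X = ∑ e, K e * X * (K e)ᴴ) (ψ : StateVector (R × Q)) (p q : R × B) :
    (N.applyRight ψ.pure).mat p q =
      ∑ e, (K e *ᵥ fun c => ψ.vec (p.1, c)) p.2 * star ((K e *ᵥ fun c => ψ.vec (q.1, c)) q.2) := by
  have h0 : (ψ.pure.mat.submatrix (fun a => (p.1, a)) (fun a => (q.1, a)) : Matrix Q Q ℂ) =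
      Matrix.vecMulVec (fun c => ψ.vec (p.1, c)) (star fun c => ψ.vec (q.1, c)) := rfl
  simp only [Channel.applyRight, ampliate, Matrix.of_apply, hK, h0, Matrix.sum_apply]
  refine Finset.sum_congr rfl fun k _ => ?_
  rw [Matrix.mul_vecMulVec, Matrix.vecMulVec_mul, ← Matrix.star_mulVec, Matrix.vecMulVec_apply]
  rfl

theorem star_dotProduct_sum_mulVec {n : Type*} {κ : Type*} [Fintype n] [Fintype κ]
    (v : n → ℂ) (y : κ → n → ℂ) :
    star v ⬝ᵥ ((Matrix.of fun p q => ∑ k, y k p * star (y k q)) *ᵥ v) =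
      ∑ k, (star v ⬝ᵥ y k) * star (star v ⬝ᵥ y k) := by
  simp only [dotProduct, Matrix.mulVec, Matrix.of_apply, star_sum,
    Finset.mul_sum, Finset.sum_mul, star_mul', Pi.star_apply, star_star]
  simp_rw [fun p => Finset.sum_comm (s := (Finset.univ : Finset n))
    (t := (Finset.univ : Finset κ)) (f := fun q k => star (v p) * (y k p * star (y k q) * v q))]
  rw [Finset.sum_comm]
  refine Finset.sum_congr rfl fun k _ => ?_
  rw [Finset.sum_comm]
  refine Finset.sum_congr rfl fun p _ => Finset.sum_congr rfl fun q _ => ?_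
  ring

/-- The entanglement fidelity in terms of Kraus operators; it depends on `ρ` only. -/
theorem entanglementFidelity_eq_sum_kraus {R : Type*} {Q : Type*} {κ : Type*} [Fintype R]
    [Fintype Q] [Fintype κ] {φ : StateVector (R × Q)} {ρ : DensityMatrix Q}
    (h : φ.IsPurification ρ) (N : Channel Q Q) (K : κ → Matrix Q Q ℂ)
    (hK : ∀ X, N.map X = ∑ k, K k * X * (K k)ᴴ) :
    entanglementFidelity φ N = ∑ k, Complex.normSq (K k * ρ.mat).trace := by
  have hz : ∀ k, (K k * ρ.mat).trace =
      ∑ r, star (fun q => φ.vec (r, q)) ⬝ᵥ (K k *ᵥ fun q => φ.vec (r, q)) := by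
    intro k
    simp only [Matrix.trace, Matrix.diag_apply, Matrix.mul_apply, h.mat_apply, dotProduct,
      Matrix.mulVec, Finset.mul_sum, Pi.star_apply]
    rw [Finset.sum_comm' (t' := Finset.univ) (s' := fun _ => Finset.univ) (by simp)]
    simp_rw [fun a : Q => Finset.sum_comm (s := (Finset.univ : Finset Q))
      (t := (Finset.univ : Finset R))
      (f := fun c r => K k c a * (φ.vec (r, a) * star (φ.vec (r, c))))]
    rw [Finset.sum_comm]
    refine Finset.sum_congr rfl fun r _ => ?_
    rw [Finset.sum_comm]
    refine Finset.sum_congr rfl fun a _ => Finset.sum_congr rfl fun c _ => ?_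
    ring
  have hsum : star φ.vec ⬝ᵥ ((N.applyRight φ.pure).mat.mulVec φ.vec) =
      ∑ k, (K k * ρ.mat).trace * star (K k * ρ.mat).trace := by
    rw [show (N.applyRight φ.pure).mat = Matrix.of fun p q => ∑ k,
        (K k *ᵥ fun c => φ.vec (p.1, c)) p.2 * star ((K k *ᵥ fun c => φ.vec (q.1, c)) q.2) from
        Matrix.ext (N.applyRight_pure_apply K hK φ),
      star_dotProduct_sum_mulVec]
    refine Finset.sum_congr rfl fun k _ => ?_
    rw [hz]
    simp only [dotProduct, Fintype.sum_prod_type, Pi.star_apply]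
  rw [entanglementFidelity, hsum]
  simp [Complex.mul_conj]

end Kraus

/-! ### Construction of the decoder. -/

section Recovery

/-- A contractive family of Kraus operators extends to a channel. -/
theorem exists_channel_extending {A : Type*} {B : Type*} {κ : Type*} [Fintype A] [DecidableEq A]
    [Fintype B] [DecidableEq B] [Nonempty B] [Fintype κ] (L : κ → Matrix B A ℂ)
    (hL : (1 - ∑ k, (L k)ᴴ * L k).PosSemidef) :
    ∃ (K : κ ⊕ A → Matrix B A ℂ) (N : Channel A B), (∀ k, K (Sum.inl k) = L k) ∧
      ∀ X, N.map X = ∑ k, K k * X * (K k)ᴴ := by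
  obtain ⟨b₀⟩ := ‹Nonempty B›
  -- The added operators send the rows of the square root of the defect to one fixed basis vector,
  -- so their sum of K†K is exactly the defect.
  let K : κ ⊕ A → Matrix B A ℂ :=
    Sum.elim L fun a => Matrix.vecMulVec (Pi.single b₀ 1) (hL.root a)
  have h1 : ∀ a, (Matrix.vecMulVec (Pi.single b₀ 1) (hL.root a))ᴴ *
      Matrix.vecMulVec (Pi.single b₀ (1 : ℂ)) (hL.root a) =
      Matrix.of fun c d => star (hL.root a c) * hL.root a d := by
    intro a
    ext c d
    rw [Matrix.mul_apply, Finset.sum_eq_single b₀] <;>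
      simp +contextual [Matrix.vecMulVec_apply]
  have h2 : ∑ a, (Matrix.vecMulVec (Pi.single b₀ 1) (hL.root a))ᴴ *
      Matrix.vecMulVec (Pi.single b₀ (1 : ℂ)) (hL.root a) = 1 - ∑ k, (L k)ᴴ * L k := by
    refine Eq.trans ?_ (show hL.rootᴴ * hL.root = _ by
      rw [hL.conjTranspose_root, hL.root_mul_root])
    ext c d
    simp only [h1, Matrix.sum_apply, Matrix.mul_apply, Matrix.of_apply,
      Matrix.conjTranspose_apply]
  have hK : ∑ k, (K k)ᴴ * K k = 1 := by
    rw [Fintype.sum_sum_type]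
    simp only [K, Sum.elim_inl, Sum.elim_inr]
    rw [h2]
    abel
  exact ⟨K, Channel.ofKraus K hK, fun _ => rfl, fun _ => rfl⟩

theorem normSq_sum_mul_le {ι : Type*} [Fintype ι] (x y : ι → ℂ) :
    Complex.normSq (∑ i, x i * y i) ≤
      (∑ i, Complex.normSq (x i)) * ∑ i, Complex.normSq (y i) := by
  simp only [Complex.normSq_eq_norm_sq]
  refine le_trans ?_ (Finset.sum_mul_sq_le_sq_mul_sq _ _ _)
  have : ‖∑ i, x i * y i‖ ≤ ∑ i, ‖x i‖ * ‖y i‖ :=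
    (norm_sum_le _ _).trans (le_of_eq (by simp))
  gcongr

theorem DensityMatrix.sum_normSq_root {n : Type*} [Fintype n] [DecidableEq n]
    (σ : DensityMatrix n) : ∑ p : n × n, Complex.normSq (σ.posSemidef.root p.1 p.2) = 1 := by
  have h : (σ.posSemidef.root * (σ.posSemidef.root)ᴴ).trace = 1 := by
    rw [σ.posSemidef.conjTranspose_root, σ.posSemidef.root_mul_root, σ.trace_eq_one]
  rw [Fintype.sum_prod_type]
  simp only [Matrix.trace, Matrix.diag_apply, Matrix.mul_apply, Matrix.conjTranspose_apply,
    Complex.star_def, Complex.mul_conj] at h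
  exact_mod_cast h

/-- Collects the blocks of the decoder into a single conjugation, where contractivity can be read
off. -/
theorem mul_kronecker_one_mul_conjTranspose {R : Type*} {E : Type*} {B : Type*}
    [Fintype R] [Fintype E] [DecidableEq E] (V : Matrix B (R × E) ℂ) (G : Matrix R R ℂ) :
    V * (G ⊗ₖ (1 : Matrix E E ℂ)) * Vᴴ = ∑ f, V.submatrix id (fun r => (r, f)) * G *
      (V.submatrix id (fun r => (r, f)))ᴴ := by
  ext a b
  simp only [Matrix.sum_apply, Matrix.mul_apply, Fintype.sum_prod_type, Matrix.kroneckerMap_apply,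
    Matrix.one_apply, mul_ite, mul_one, mul_zero, Finset.sum_ite_eq',
    Finset.mem_univ, if_true, Matrix.conjTranspose_apply, Matrix.submatrix_apply, id_eq]
  exact Finset.sum_comm

/-- Decoding from decoupling. The rows of `M` are a purification of the joint state `τ` of the
reference `R` and the environment `E`, with purifying system `B`; the rows of `A` are a purification
of the reference state. -/
theorem exists_contractive_recovery {R : Type*} {E : Type*} {B : Type*} {Q : Type*}
    [Fintype R] [DecidableEq R] [Fintype E] [DecidableEq E] [Fintype B] [DecidableEq B]
    [Fintype Q] [DecidableEq Q] (τ : DensityMatrix (R × E)) (M : Matrix (R × E) B ℂ)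
    (hM : M * Mᴴ = τ.mat) (A : Matrix R Q ℂ) (hA : A * Aᴴ = τ.marginalLeft.mat)
    (K : E → Matrix B Q ℂ) (hK : ∀ e, M.submatrix (fun r => (r, e)) id = A * (K e)ᵀ)
    (t : ℝ) (ht : (τ.posSemidef.root *
        (τ.marginalLeft.posSemidef.root ⊗ₖ τ.marginalRight.posSemidef.root)).trace = (t : ℂ)) :
    ∃ L : E → Matrix Q B ℂ, (1 - ∑ f, (L f)ᴴ * L f).PosSemidef ∧
      t ^ 2 ≤ ∑ p : E × E, Complex.normSq (L p.1 * K p.2 * (Aᴴ * A)ᵀ).trace := by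
  obtain ⟨U, -, hMU, hU⟩ := exists_polar M τ.posSemidef hM
  obtain ⟨Z, hZA, -, hZ⟩ := exists_polar A τ.marginalLeft.posSemidef hA
  -- With M = √τ U and A = √τ^R Z, this choice makes U† cancel the phase of M and Z that of A† under
  -- the trace, leaving blocks of √τ times √τ^R.
  let L : E → Matrix Q B ℂ := fun f => ((U.submatrix (fun r => (r, f)) id)ᴴ * Z)ᵀ
  refine ⟨L, ?_, ?_⟩
  · have hsum : ∑ f, (L f)ᴴ * L f =
        Uᵀ * ((Z * Zᴴ)ᵀ ⊗ₖ (1 : Matrix E E ℂ)) * (Uᵀ)ᴴ := by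
      rw [mul_kronecker_one_mul_conjTranspose]
      refine Finset.sum_congr rfl fun f _ => ?_
      have h1 : ((U.submatrix (fun r => (r, f)) id)ᴴ)ᵀ =
          (Uᵀ.submatrix id (fun r => (r, f)))ᴴ := rfl
      have h2 : (Zᵀ)ᴴ = (Zᴴ)ᵀ := rfl
      simp only [L, Matrix.transpose_mul, Matrix.conjTranspose_mul, Matrix.mul_assoc, h1, h2,
        Matrix.conjTranspose_conjTranspose]
    have hZ' : (1 - (Z * Zᴴ)ᵀ).PosSemidef := by
      have h : (1 - (Zᴴ)ᴴ * Zᴴ).PosSemidef := posSemidef_one_sub_of_partialIsometry (by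
        rw [Matrix.conjTranspose_conjTranspose]
        simpa [Matrix.mul_assoc] using congrArg Matrix.conjTranspose hZ)
      simpa using h.transpose
    have hU' : (1 - Uᵀ * (Uᵀ)ᴴ).PosSemidef := by
      have h := (posSemidef_one_sub_of_partialIsometry hU).transpose
      rwa [Matrix.transpose_sub, Matrix.transpose_one, Matrix.transpose_mul] at h
    -- The defect splits into the defect of U and the conjugated defect of Z, both positive because
    -- U and Z are partial isometries.
    have h1 : 1 - ∑ f, (L f)ᴴ * L f = (1 - Uᵀ * (Uᵀ)ᴴ) +
        Uᵀ * ((1 - (Z * Zᴴ)ᵀ) ⊗ₖ (1 : Matrix E E ℂ)) * (Uᵀ)ᴴ := by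
      have h2 : (1 - (Z * Zᴴ)ᵀ) ⊗ₖ (1 : Matrix E E ℂ) = 1 - (Z * Zᴴ)ᵀ ⊗ₖ (1 : Matrix E E ℂ) := by
        rw [eq_sub_iff_add_eq, ← Matrix.add_kronecker, sub_add_cancel, Matrix.one_kronecker_one]
      rw [hsum, h2, Matrix.mul_sub, Matrix.sub_mul, Matrix.mul_one]
      abel
    rw [h1]
    exact hU'.add ((hZ'.kronecker Matrix.PosSemidef.one).mul_mul_conjTranspose_same _)
  · have htr : ∀ f e, (L f * K e * (Aᴴ * A)ᵀ).trace =
        ∑ r, ∑ s, τ.posSemidef.root (r, e) (s, f) * τ.marginalLeft.posSemidef.root s r := by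
      intro f e
      have h1 : (L f * K e * (Aᴴ * A)ᵀ) =
          (Aᴴ * ((M.submatrix (fun r => (r, e)) id) *
            (U.submatrix (fun r => (r, f)) id)ᴴ * Z))ᵀ := by
        rw [hK]
        simp [L, Matrix.transpose_mul, Matrix.mul_assoc]
      have h2 : (M.submatrix (fun r => (r, e)) id) * (U.submatrix (fun r => (r, f)) id)ᴴ =
          τ.posSemidef.root.submatrix (fun r => (r, e)) (fun r => (r, f)) := by
        rw [← hMU]; rfl
      rw [h1, Matrix.trace_transpose, Matrix.trace_mul_comm, h2, Matrix.mul_assoc, hZA]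
      simp [Matrix.trace, Matrix.mul_apply]
    have hsum : ∑ p : E × E, (L p.1 * K p.2 * (Aᴴ * A)ᵀ).trace *
        τ.marginalRight.posSemidef.root p.1 p.2 = (t : ℂ) := by
      rw [← ht]
      simp only [htr]
      simp only [Matrix.trace, Matrix.diag_apply, Matrix.mul_apply, Fintype.sum_prod_type,
        Matrix.kroneckerMap_apply, Finset.sum_mul]
      rw [Finset.sum_comm]
      conv_rhs => rw [Finset.sum_comm]
      refine Finset.sum_congr rfl fun e _ => ?_
      rw [Finset.sum_comm]
      refine Finset.sum_congr rfl fun r _ => ?_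
      rw [Finset.sum_comm]
      simp only [mul_assoc]
    -- Cauchy–Schwarz against √τ^E, whose Hilbert–Schmidt norm is 1 because Tr τ^E = 1.
    have h := normSq_sum_mul_le (fun p : E × E => (L p.1 * K p.2 * (Aᴴ * A)ᵀ).trace)
      (fun p => τ.marginalRight.posSemidef.root p.1 p.2)
    rw [hsum, τ.marginalRight.sum_normSq_root, mul_one, Complex.normSq_ofReal] at h
    rwa [sq]

end Recovery

/-! ### Complementary mutual informations. -/

section Complementary

/-- The joint state of reference and environment after the channel. Its mutual information is
complementary to the one of reference and output. -/
theorem exists_environment_state {R : Type*} {Q : Type*} {B : Type*} {E : Type*} [Fintype R]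
    [DecidableEq R] [Fintype Q] [DecidableEq Q] [Fintype B] [DecidableEq B] [Fintype E]
    [DecidableEq E] (N : Channel Q B) (K : E → Matrix B Q ℂ)
    (hK : ∀ X, N.map X = ∑ e, K e * X * (K e)ᴴ) (ρ : DensityMatrix Q) (ψ : StateVector (R × Q))
    (hψ : ψ.IsPurification ρ) :
    ∃ (τ : DensityMatrix (R × E)) (M : Matrix (R × E) B ℂ) (A : Matrix R Q ℂ),
      M * Mᴴ = τ.mat ∧ A * Aᴴ = τ.marginalLeft.mat ∧ ρ.mat = (Aᴴ * A)ᵀ ∧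
      (∀ e, M.submatrix (fun r => (r, e)) id = A * (K e)ᵀ) ∧
      mutualInformation τ + mutualInformation (N.applyRight ψ.pure) = 2 * vonNeumannEntropy ρ := by
  set σ := N.applyRight ψ.pure with hσ
  let A : Matrix R Q ℂ := Matrix.of fun r q => ψ.vec (r, q)
  -- The dilated pure state on R, E and B, reshaped as a matrix across the cut RE | B.
  let M : Matrix (R × E) B ℂ := Matrix.of fun p b => (K p.2 *ᵥ fun c => ψ.vec (p.1, c)) b
  have hσ' : ∀ p q : R × B, σ.mat p q = ∑ e, M (p.1, e) p.2 * star (M (q.1, e) q.2) :=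
    N.applyRight_pure_apply K hK ψ
  have hM : ∀ p q, (M * Mᴴ) p q = ∑ b, M p b * star (M q b) := fun p q => Matrix.mul_apply
  have htr : (M * Mᴴ).trace = 1 := by
    rw [← σ.trace_eq_one]
    simp only [Matrix.trace, Matrix.diag_apply, hσ', hM, Fintype.sum_prod_type]
    exact Finset.sum_congr rfl fun r _ => Finset.sum_comm
  let τ : DensityMatrix (R × E) :=
    ⟨M * Mᴴ, Matrix.posSemidef_self_mul_conjTranspose M, htr⟩
  have hleft : τ.marginalLeft = σ.marginalLeft := by
    have : τ.marginalLeft.mat = σ.marginalLeft.mat := by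
      ext r s
      simp only [DensityMatrix.marginalLeft, Matrix.sum_apply, Matrix.submatrix_apply, hσ', τ, hM]
      exact Finset.sum_comm
    cases h1 : τ.marginalLeft
    cases h2 : σ.marginalLeft
    simp_all
  have hA : A * Aᴴ = σ.marginalLeft.mat := by
    ext r s
    have h := N.tracePreserving
      (ψ.pure.mat.submatrix (fun a => (r, a)) (fun a => (s, a)))
    simp only [Matrix.trace, Matrix.diag_apply] at h
    simp only [Matrix.mul_apply, DensityMatrix.marginalLeft, Matrix.sum_apply]
    exact h.symm
  have hρ : ρ.mat = (Aᴴ * A)ᵀ := by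
    ext q q'
    rw [hψ.mat_apply, Matrix.transpose_apply, Matrix.mul_apply]
    exact Finset.sum_congr rfl fun r _ => mul_comm _ _
  refine ⟨τ, M, A, rfl, by rw [hleft, hA], hρ, fun e => ?_, ?_⟩
  · ext r b
    simp only [M, A, Matrix.submatrix_apply, Matrix.of_apply, Matrix.mulVec, dotProduct,
      Matrix.mul_apply, Matrix.transpose_apply, id_eq]
    exact Finset.sum_congr rfl fun q _ => mul_comm _ _
  -- Equality of marginal entropies of a pure state, for three cuts: R | Q of `ψ`, then RE | B and
  -- RB | E of the dilated state. Each follows by comparing X X† with X† X, up to a transpose.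
  · have e1 : vonNeumannEntropy ρ = vonNeumannEntropy σ.marginalLeft :=
      vonNeumannEntropy_eq_of_mul_comm _ _ Aᴴ A (by rw [hρ, Matrix.charpoly_transpose])
        (by rw [hA])
    have e2 : vonNeumannEntropy σ.marginalRight = vonNeumannEntropy τ := by
      refine vonNeumannEntropy_eq_of_mul_comm _ _ Mᴴ M ?_ rfl
      rw [← Matrix.charpoly_transpose (Mᴴ * M)]
      congr 1
      ext a b
      simp only [DensityMatrix.marginalRight, Matrix.sum_apply, Matrix.submatrix_apply, hσ',
        Matrix.transpose_apply, Matrix.mul_apply, Fintype.sum_prod_type,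
        Matrix.conjTranspose_apply, mul_comm]
    have e3 : vonNeumannEntropy σ = vonNeumannEntropy τ.marginalRight := by
      let X : Matrix (R × B) E ℂ := Matrix.of fun p e => M (p.1, e) p.2
      refine vonNeumannEntropy_eq_of_mul_comm _ _ X Xᴴ ?_ ?_
      · congr 1
        ext p q
        rw [hσ', Matrix.mul_apply]
        rfl
      · rw [← Matrix.charpoly_transpose (Xᴴ * X)]
        congr 1
        ext a b
        simp only [DensityMatrix.marginalRight, Matrix.sum_apply, Matrix.submatrix_apply, τ, hM,
          Matrix.transpose_apply, Matrix.mul_apply, Fintype.sum_prod_type, X, Matrix.of_apply,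
          Matrix.conjTranspose_apply, mul_comm]
    unfold mutualInformation
    rw [hleft, e1, e2, e3]
    ring

end Complementary

/-! ### The recovery theorem. -/

theorem theorem2 (E : BipartiteMeasure.{u})
    (hE : ∀ (A B : Type u) [Fintype A] [DecidableEq A] [Fintype B] [DecidableEq B]
      (σ : DensityMatrix (A × B)), E A B σ ≤ mutualInformation σ / 2)
    (Q Q' R : Type u) [Fintype Q] [DecidableEq Q] [Fintype Q'] [DecidableEq Q']
    [Fintype R] [DecidableEq R]
    (ρ : DensityMatrix Q) (N : Channel Q Q')
    (ψ : StateVector (R × Q)) (hψ : ψ.IsPurification ρ) :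
    0 ≤ vonNeumannEntropy ρ - E R Q' (N.applyRight ψ.pure) ∧
    ∃ 𝓡 : Channel Q' Q,
      ∀ (R' : Type u) [Fintype R'] (φ : StateVector (R' × Q)),
        φ.IsPurification ρ →
          entanglementFidelity φ (𝓡.comp N) ≥
            1 - 2 * √(vonNeumannEntropy ρ - E R Q' (N.applyRight ψ.pure)) := by
  obtain ⟨K, hK⟩ := N.exists_kraus
  obtain ⟨τ, M, A, hM, hA, hρ, hMK, hI⟩ := exists_environment_state N K hK ρ ψ hψ
  obtain ⟨t, ht, hlow, hup⟩ := exists_overlap τ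
  have hε := hE R Q' (N.applyRight ψ.pure)
  set ε := vonNeumannEntropy ρ - E R Q' (N.applyRight ψ.pure) with hεdef
  have hlog := Real.log_pos one_lt_two
  have hlog1 : Real.log 2 ≤ 1 := by linarith [Real.log_two_lt_d9]
  have hIε : mutualInformation τ ≤ 2 * ε := by linarith
  -- Negative mutual information would force t > 1 through the lower bound on the overlap.
  have hI0 : 0 ≤ mutualInformation τ := by
    by_contra! h
    nlinarith
  have hε0 : 0 ≤ ε := by linarith
  refine ⟨hε0, ?_⟩
  obtain ⟨L, hL, hLt⟩ := exists_contractive_recovery τ M hM A hA K hMK t ht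
  have hQ : Nonempty Q := by
    by_contra h
    rw [not_nonempty_iff] at h
    simpa using ρ.trace_eq_one
  obtain ⟨D, 𝓡, hDL, hD⟩ := exists_channel_extending L hL
  refine ⟨𝓡, fun R' _ φ hφ => ?_⟩
  rw [entanglementFidelity_eq_sum_kraus hφ (𝓡.comp N) (fun p : _ × (Q × Q') => D p.1 * K p.2)]
  swap
  · intro X
    simp only [Channel.comp, LinearMap.comp_apply, hK, hD, Fintype.sum_prod_type, Matrix.mul_sum,
      Matrix.sum_mul, Matrix.conjTranspose_mul, Matrix.mul_assoc]
  have hF : t ^ 2 ≤ ∑ p : ((Q × Q') ⊕ Q') × (Q × Q'),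
      Complex.normSq (D p.1 * K p.2 * ρ.mat).trace := by
    rw [← hρ, Fintype.sum_prod_type] at hLt
    refine hLt.trans ?_
    -- Only the Kraus operators `L` of the decoder are kept; those completing it to a channel
    -- contribute nonnegative terms.
    conv_rhs => rw [Fintype.sum_prod_type, Fintype.sum_sum_type]
    simp only [hDL]
    exact le_add_of_nonneg_right
      (Finset.sum_nonneg fun _ _ => Finset.sum_nonneg fun _ _ => Complex.normSq_nonneg _)
  refine ge_iff_le.2 (le_trans ?_ hF)
  have hs := Real.sq_sqrt hε0
  have hs0 := Real.sqrt_nonneg ε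
  -- For √ε ≥ 1 the claimed bound is negative. Otherwise t ≥ 1 - (ln 2) ε ≥ 1 - √ε > 0, and squaring
  -- gives the claim.
  rcases le_or_gt 1 (√ε) with h1 | h1
  · nlinarith [sq_nonneg t]
  · have h2 : ε ≤ √ε := by nlinarith
    have h3 : 1 - √ε ≤ t := by nlinarith
    nlinarith
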